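/- Let $p,q\ge 0$ be integers with $n=p+q\ge 1$. Let $\mathbb R^{2p+1,2q}$ be $\mathbb R^{2n+1}$ with the scalar product $\langle x,y\rangle=\sum_{i=1}^{2p+1}x_iy_i-\sum_{j=2p+2}^{2n+1}x_jy_j$, and let $$S^{2n}_{2q}=\{x\in\mathbb R^{2p+1,2q}:\langle x,x\rangle=1\}$$ be the pseudo-sphere, with the pseudo-Riemannian metric of signature $(2p,2q)$ obtained by restricting $\langle\cdot,\cdot\rangle$ to its tangent spaces $T_xS^{2n}_{2q}=x^{\perp}$. A pseudo-Kähler structure on $S^{2n}_{2q}$ compatible with this metric is a smooth field $J$ of endomorphisms of the tangent spaces such that 1. $J^2=-1$ and $J$ is integrable, that is, $[JX,JY]-J[JX,Y]-J[X,JY]-[X,Y]=0$ for all smooth vector fields $X,Y$ on $S^{2n}_{2q}$; 2. $J$ is orthogonal, that is, $\langle JX,JY\rangle=\langle X,Y\rangle$; 3. the 2-form $\omega(X,Y)=\langle JX,Y\rangle$ is closed, $\mathrm d\omega=0$. Then $S^{2n}_{2q}$ admits a pseudo-Kähler structure compatible with its metric if and only if $p+q=1$. In particular, it admits none when $p+q\ge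 2$. -/

import Mathlib

open scoped ContDiff

/-- The vector space underlying the semi-Euclidean space `ℝ^{a,b}`. Only its linear structure,
its (unique) vector space topology and the scalar product below are used. -/
abbrev SemiEuclidean (a b : ℕ) : Type := Fin a ⊕ Fin b → ℝ

/-- The scalar product of `ℝ^{a,b}`, with `a` plus signs followed by `b` minus signs. -/
def semiInner {a b : ℕ} (x y : SemiEuclidean a b) : ℝ :=
  ∑ i : Fin a, x (Sum.inl i) * y (Sum.inl i) - ∑ j : Fin b, x (Sum.inr j) * y (Sum.inr j)

/-- The pseudo-sphere `S^{2n}_{2q}`, `n = p + q`: the vectors of norm `1` in `ℝ^{2p+1,2q}`. -/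
def pseudoSphere (p q : ℕ) : Set (SemiEuclidean (2 * p + 1) (2 * q)) :=
  {x | semiInner x x = 1}

/-- The tangent space of the pseudo-sphere at `x`: the orthogonal complement of `x`.
See `mem_tangent_iff_mem_tangentConeAt`. The metric of the pseudo-sphere is the restriction of
`semiInner` to these spaces. -/
def pseudoSphere.tangent {p q : ℕ} (x : SemiEuclidean (2 * p + 1) (2 * q)) :
    Submodule ℝ (SemiEuclidean (2 * p + 1) (2 * q)) where
  carrier := {v | semiInner x v = 0}
  add_mem' := by
    intro v w hv hw
    simp only [Set.mem_ofPred_eq, semiInner, Pi.add_apply, mul_add, Finset.sum_add_distrib] at *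
    linarith
  zero_mem' := by simp [semiInner]
  smul_mem' := by
    intro c v hv
    simp only [Set.mem_ofPred_eq, semiInner, Pi.smul_apply, smul_eq_mul, mul_left_comm _ c,
      ← Finset.mul_sum, ← mul_sub] at *
    rw [hv, mul_zero]

namespace pseudoSphere

/-- The tangent spaces as defined above are the tangent cones of the pseudo-sphere. -/
theorem mem_tangent_iff_mem_tangentConeAt {p q : ℕ} {x v : SemiEuclidean (2 * p + 1) (2 * q)}
    (hx : x ∈ pseudoSphere p q) :
    v ∈ tangent x ↔ v ∈ tangentConeAt ℝ (pseudoSphere p q) x := by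
  have hx1 : semiInner x x = 1 := hx
  have hd : Differentiable ℝ
      (fun y : SemiEuclidean (2 * p + 1) (2 * q) => semiInner y y) := by
    unfold semiInner; fun_prop
  have hdv : ∀ w, fderiv ℝ (fun y : SemiEuclidean (2 * p + 1) (2 * q) => semiInner y y) x w
      = 2 * semiInner x w := by
    intro w
    have hline : HasDerivAt (fun t : ℝ => semiInner (x + t • w) (x + t • w))
        (fderiv ℝ (fun y : SemiEuclidean (2 * p + 1) (2 * q) => semiInner y y) x w) 0 :=
      (hd x).hasFDerivAt.hasLineDerivAt w
    have hpoly : (fun t : ℝ => semiInner (x + t • w) (x + t • w))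
        = fun t : ℝ => semiInner x x + 2 * semiInner x w * t + semiInner w w * t ^ 2 := by
      funext t
      simp only [semiInner, Pi.add_apply, Pi.smul_apply, smul_eq_mul, mul_sub, sub_mul,
        Finset.mul_sum, Finset.sum_mul]
      rw [sub_add_sub_comm, sub_add_sub_comm]
      simp only [← Finset.sum_add_distrib]
      congr 1 <;> refine Finset.sum_congr rfl fun i _ => by ring
    rw [hpoly] at hline
    have h2 : HasDerivAt (fun t : ℝ => semiInner x x + 2 * semiInner x w * t
        + semiInner w w * t ^ 2) (2 * semiInner x w) 0 := by
      have := (((hasDerivAt_id (0 : ℝ)).const_mul (2 * semiInner x w)).const_add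
        (semiInner x x)).fun_add (((hasDerivAt_id (0 : ℝ)).pow 2).const_mul (semiInner w w))
      simpa using this
    exact hline.unique h2
  constructor
  · intro hv
    have hv0 : semiInner x v = 0 := hv
    have hsq : HasFDerivAt (fun y : SemiEuclidean (2 * p + 1) (2 * q) => semiInner y y)
        (fderiv ℝ (fun y : SemiEuclidean (2 * p + 1) (2 * q) => semiInner y y) x) x :=
      (hd x).hasFDerivAt
    have hinv : HasDerivAt (fun s : ℝ => (Real.sqrt s)⁻¹) (-(1 / 2)) (semiInner x x) := by
      rw [hx1]
      have := (Real.hasDerivAt_sqrt (one_ne_zero)).fun_inv (by simp)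
      simpa [neg_div] using this
    have hrd := (HasDerivAt.comp_hasFDerivAt
      (f := fun y : SemiEuclidean (2 * p + 1) (2 * q) => semiInner y y) x hinv hsq).smul (hasFDerivAt_id x)
    have hcone := (hrd.hasFDerivWithinAt (s := {y | 0 < semiInner y y})).mapsTo_tangent_cone
    have hopen : {y : SemiEuclidean (2 * p + 1) (2 * q) | 0 < semiInner y y} ∈ nhds x :=
      (isOpen_lt continuous_const hd.continuous).mem_nhds (by simp [hx1])
    rw [tangentConeAt_of_mem_nhds hopen] at hcone
    have hmem := hcone (Set.mem_univ v)
    have hval : (((fun s : ℝ => (Real.sqrt s)⁻¹) ∘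
        (fun y : SemiEuclidean (2 * p + 1) (2 * q) => semiInner y y)) • id) x = x := by
      simp [hx1]
    rw [hval] at hmem
    have hsub : (((fun s : ℝ => (Real.sqrt s)⁻¹) ∘
        (fun y : SemiEuclidean (2 * p + 1) (2 * q) => semiInner y y)) • id) ''
        {y | 0 < semiInner y y} ⊆ pseudoSphere p q := by
      rintro _ ⟨y, hy, rfl⟩
      have hy0 : 0 < semiInner y y := hy
      have hs : ∀ c : ℝ, semiInner (c • y) (c • y) = c ^ 2 * semiInner y y := by
        intro c
        simp only [semiInner, Pi.smul_apply, smul_eq_mul, mul_sub, Finset.mul_sum]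
        congr 1 <;> refine Finset.sum_congr rfl fun i _ => by ring
      change semiInner ((Real.sqrt (semiInner y y))⁻¹ • y)
        ((Real.sqrt (semiInner y y))⁻¹ • y) = 1
      rw [hs, inv_pow, Real.sq_sqrt hy0.le, inv_mul_cancel₀ hy0.ne']
    have := tangentConeAt_mono hsub hmem
    simpa [hdv, hv0, hx1] using this
  · intro hv
    have h1 : HasFDerivWithinAt (fun y : SemiEuclidean (2 * p + 1) (2 * q) => semiInner y y)
        (fderiv ℝ (fun y : SemiEuclidean (2 * p + 1) (2 * q) => semiInner y y) x)
        (pseudoSphere p q) x := (hd x).hasFDerivAt.hasFDerivWithinAt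
    have h2 : HasFDerivWithinAt (fun y : SemiEuclidean (2 * p + 1) (2 * q) => semiInner y y)
        (0 : SemiEuclidean (2 * p + 1) (2 * q) →L[ℝ] ℝ) (pseudoSphere p q) x :=
      (hasFDerivWithinAt_const (1 : ℝ) x _).congr (fun y hy => hy) hx
    have h3 := h1.unique_on h2 hv
    rw [hdv] at h3
    change semiInner x v = 0
    simpa using h3

/-- On tangent vectors the derivative within the pseudo-sphere is well defined: it agrees with the
derivative of any extension. -/
theorem fderivWithin_eq_of_mem_tangent {p q : ℕ} {F : Type*} [NormedAddCommGroup F]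
    [NormedSpace ℝ F] {f : SemiEuclidean (2 * p + 1) (2 * q) → F}
    {f' : SemiEuclidean (2 * p + 1) (2 * q) →L[ℝ] F} {x v : SemiEuclidean (2 * p + 1) (2 * q)}
    (hf : HasFDerivWithinAt f f' (pseudoSphere p q) x) (hx : x ∈ pseudoSphere p q)
    (hv : v ∈ tangent x) : fderivWithin ℝ f (pseudoSphere p q) x v = f' v :=
  hf.differentiableWithinAt.hasFDerivWithinAt.unique_on hf
    ((mem_tangent_iff_mem_tangentConeAt hx).1 hv)

/-- Smooth tangent vector fields on the pseudo-sphere (values off the pseudo-sphere are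
irrelevant). As the pseudo-sphere is a closed embedded submanifold, a map on it is smooth exactly
when it is smooth on this subset of the ambient vector space. -/
def IsSmoothVectorField {p q : ℕ}
    (X : SemiEuclidean (2 * p + 1) (2 * q) → SemiEuclidean (2 * p + 1) (2 * q)) : Prop :=
  ContDiffOn ℝ ∞ X (pseudoSphere p q) ∧ ∀ x ∈ pseudoSphere p q, X x ∈ tangent x

/-- The derivative of a function `f` on the pseudo-sphere along a tangent vector field `X`. The
derivative within the pseudo-sphere is only determined on tangent vectors, the only
ones to which it is applied here; see `fderivWithin_eq_of_mem_tangent`. -/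
noncomputable def dirDeriv {p q : ℕ}
    (X : SemiEuclidean (2 * p + 1) (2 * q) → SemiEuclidean (2 * p + 1) (2 * q))
    (f : SemiEuclidean (2 * p + 1) (2 * q) → ℝ) (x : SemiEuclidean (2 * p + 1) (2 * q)) : ℝ :=
  fderivWithin ℝ f (pseudoSphere p q) x (X x)

/-- The Lie bracket `[X, Y]` of tangent vector fields on the pseudo-sphere. -/
noncomputable def bracket {p q : ℕ}
    (X Y : SemiEuclidean (2 * p + 1) (2 * q) → SemiEuclidean (2 * p + 1) (2 * q)) :
    SemiEuclidean (2 * p + 1) (2 * q) → SemiEuclidean (2 * p + 1) (2 * q) :=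
  VectorField.lieBracketWithin ℝ X Y (pseudoSphere p q)

/-- A smooth almost complex structure on the pseudo-sphere: a smooth field of endomorphisms `J x`
of the tangent spaces with `J ^ 2 = -1`. The endomorphism of the tangent space at `x` is
represented by an endomorphism of the ambient space preserving the tangent space, whose values on
other vectors are irrelevant (one may always extend by `J x x = 0`). -/
structure IsAlmostComplex {p q : ℕ}
    (J : SemiEuclidean (2 * p + 1) (2 * q) →
      SemiEuclidean (2 * p + 1) (2 * q) →L[ℝ] SemiEuclidean (2 * p + 1) (2 * q)) : Prop where
  smooth : ContDiffOn ℝ ∞ J (pseudoSphere p q)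
  map_tangent : ∀ x ∈ pseudoSphere p q, ∀ v ∈ tangent x, J x v ∈ tangent x
  sq_eq_neg : ∀ x ∈ pseudoSphere p q, ∀ v ∈ tangent x, J x (J x v) = -v

/-- The Nijenhuis tensor `N(X, Y) = [JX, JY] - J[JX, Y] - J[X, JY] - [X, Y]`. -/
noncomputable def nijenhuis {p q : ℕ}
    (J : SemiEuclidean (2 * p + 1) (2 * q) →
      SemiEuclidean (2 * p + 1) (2 * q) →L[ℝ] SemiEuclidean (2 * p + 1) (2 * q))
    (X Y : SemiEuclidean (2 * p + 1) (2 * q) → SemiEuclidean (2 * p + 1) (2 * q))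
    (x : SemiEuclidean (2 * p + 1) (2 * q)) : SemiEuclidean (2 * p + 1) (2 * q) :=
  bracket (fun y => J y (X y)) (fun y => J y (Y y)) x
    - J x (bracket (fun y => J y (X y)) Y x)
    - J x (bracket X (fun y => J y (Y y)) x)
    - bracket X Y x

/-- A complex structure: an almost complex structure which is integrable, that is, whose
Nijenhuis tensor vanishes. -/
structure IsComplexStructure {p q : ℕ}
    (J : SemiEuclidean (2 * p + 1) (2 * q) →
      SemiEuclidean (2 * p + 1) (2 * q) →L[ℝ] SemiEuclidean (2 * p + 1) (2 * q)) : Prop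
    extends IsAlmostComplex J where
  integrable : ∀ X Y, IsSmoothVectorField X → IsSmoothVectorField Y →
    ∀ x ∈ pseudoSphere p q, nijenhuis J X Y x = 0

/-- `J` is compatible with the metric of the pseudo-sphere: it is orthogonal. -/
def IsOrthogonal {p q : ℕ}
    (J : SemiEuclidean (2 * p + 1) (2 * q) →
      SemiEuclidean (2 * p + 1) (2 * q) →L[ℝ] SemiEuclidean (2 * p + 1) (2 * q)) : Prop :=
  ∀ x ∈ pseudoSphere p q, ∀ v ∈ tangent x, ∀ w ∈ tangent x,
    semiInner (J x v) (J x w) = semiInner v w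

/-- The associated 2-form `ω(X, Y) = ⟨JX, Y⟩`, evaluated on vector fields. -/
def kahlerForm {p q : ℕ}
    (J : SemiEuclidean (2 * p + 1) (2 * q) →
      SemiEuclidean (2 * p + 1) (2 * q) →L[ℝ] SemiEuclidean (2 * p + 1) (2 * q))
    (X Y : SemiEuclidean (2 * p + 1) (2 * q) → SemiEuclidean (2 * p + 1) (2 * q))
    (x : SemiEuclidean (2 * p + 1) (2 * q)) : ℝ :=
  semiInner (J x (X x)) (Y x)

/-- The exterior derivative of the associated 2-form, evaluated on vector fields:
`dω(X, Y, Z) = X ω(Y, Z) + Y ω(Z, X) + Z ω(X, Y) - ω([X, Y], Z) - ω([Y, Z], X) - ω([Z, X], Y)`. -/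
noncomputable def dKahlerForm {p q : ℕ}
    (J : SemiEuclidean (2 * p + 1) (2 * q) →
      SemiEuclidean (2 * p + 1) (2 * q) →L[ℝ] SemiEuclidean (2 * p + 1) (2 * q))
    (X Y Z : SemiEuclidean (2 * p + 1) (2 * q) → SemiEuclidean (2 * p + 1) (2 * q))
    (x : SemiEuclidean (2 * p + 1) (2 * q)) : ℝ :=
  dirDeriv X (kahlerForm J Y Z) x + dirDeriv Y (kahlerForm J Z X) x
    + dirDeriv Z (kahlerForm J X Y) x
    - kahlerForm J (bracket X Y) Z x - kahlerForm J (bracket Y Z) X x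
    - kahlerForm J (bracket Z X) Y x

/-- `J` makes the pseudo-sphere, with its usual metric, a pseudo-Kähler manifold: `J` is a complex
structure, compatible with the metric, and the associated 2-form is closed. -/
structure IsPseudoKahler {p q : ℕ}
    (J : SemiEuclidean (2 * p + 1) (2 * q) →
      SemiEuclidean (2 * p + 1) (2 * q) →L[ℝ] SemiEuclidean (2 * p + 1) (2 * q)) : Prop
    extends IsComplexStructure J where
  orthogonal : IsOrthogonal J
  closed : ∀ X Y Z, IsSmoothVectorField X → IsSmoothVectorField Y → IsSmoothVectorField Z →
    ∀ x ∈ pseudoSphere p q, dKahlerForm J X Y Z x = 0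

end pseudoSphere

/-!
A pseudo-Kähler structure `J` is parallel for the Levi-Civita connection: writing
`A(u, v, w) = ⟪(∇_u J) v, w⟫`, the closedness of `ω` and the vanishing of the Nijenhuis tensor
combine to `2 A = 0` (`IsPseudoKahler.parallel`). A parallel `J` commutes with the curvature
operators `R(u, w) v = ⟪w, v⟫ u - ⟪u, v⟫ w` of the pseudo-sphere, which has constant curvature `1`
(`IsPseudoKahler.curvature_comm`). For a non-null tangent vector `v` and a tangent vector `u`
orthogonal to `v` and `Jv`, applying this with `w = v` gives `⟪v, v⟫ J u = 0`, hence `u = 0`. In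
dimension at least `4` there is such a `u ≠ 0` (`IsPseudoKahler.add_lt_two`).

No connection or curvature tensor is introduced: `J` is extended to the open cone `⟪y, y⟫ > 0` of
the ambient space by `K y = J (y / √⟪y, y⟫) ∘ (tangential projection)`. The tangential parts of the
derivatives of `K` on tangent vectors are the covariant derivatives of `J`. If `J` is parallel,
then on the pseudo-sphere `(D_u K) v = -(⟪K v, u⟫ x + ⟪x, v⟫ K u)`
(`IsPseudoKahler.fderiv_radialExt`), and differentiating this once more, the symmetry of the
second derivative of `K` is the commutation with the curvature. As test fields in the conditions
on `J`, the projections `y ↦ v - ⟪y, v⟫ y` of constant vectors suffice: those of `v` and `w`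
commute at the points where `v` and `w` are tangent, and `J` maps them to `y ↦ K y v`.

Conversely, for `p + q = 1` the ambient space `ℝ^3` or `ℝ^{1,2}` carries a cross product, and
`J x v = x × v` is a pseudo-Kähler structure (`isPseudoKahler_of_cross`).
-/

/-! ### The scalar product as a bilinear form -/

/-- The scalar product of `ℝ^{a,b}` as a continuous bilinear form. -/
noncomputable def semiForm (a b : ℕ) :
    SemiEuclidean a b →L[ℝ] SemiEuclidean a b →L[ℝ] ℝ :=
  (LinearMap.mk₂ ℝ semiInner
    (fun x y z => by
      simp only [semiInner, Pi.add_apply, add_mul, Finset.sum_add_distrib]; ring)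
    (fun c x y => by
      simp only [semiInner, Pi.smul_apply, smul_eq_mul, mul_assoc, ← Finset.mul_sum, mul_sub])
    (fun x y z => by
      simp only [semiInner, Pi.add_apply, mul_add, Finset.sum_add_distrib]; ring)
    (fun c x y => by
      simp only [semiInner, Pi.smul_apply, smul_eq_mul, mul_left_comm _ c, ← Finset.mul_sum,
        mul_sub])).toContinuousBilinearMap

theorem semiInner_eq_semiForm {a b : ℕ} (x y : SemiEuclidean a b) :
    semiInner x y = semiForm a b x y := rfl

theorem semiForm_comm {a b : ℕ} (x y : SemiEuclidean a b) :
    semiForm a b x y = semiForm a b y x := by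
  simp only [← semiInner_eq_semiForm, semiInner, mul_comm]

theorem eq_zero_of_semiForm_eq_zero {a b : ℕ} {x : SemiEuclidean a b}
    (h : ∀ y, semiForm a b x y = 0) : x = 0 := by
  funext k
  have hk := h (Pi.single k 1)
  rcases k with i | j
  · simpa [← semiInner_eq_semiForm, semiInner, Pi.single_apply] using hk
  · simpa [← semiInner_eq_semiForm, semiInner, Pi.single_apply] using hk

namespace pseudoSphere

variable {p q : ℕ}

/-- The vector space `ℝ^{2p+1,2q}` containing the pseudo-sphere. -/
abbrev Ambient (p q : ℕ) : Type := SemiEuclidean (2 * p + 1) (2 * q)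

local notation "⟪" x "," y "⟫" => semiForm (2 * _ + 1) (2 * _) x y

theorem mem_iff {x : Ambient p q} : x ∈ pseudoSphere p q ↔ ⟪x, x⟫ = 1 := Iff.rfl

theorem mem_tangent_iff {x v : Ambient p q} : v ∈ tangent x ↔ ⟪x, v⟫ = 0 := Iff.rfl

/-! ### Derivatives along the pseudo-sphere -/

theorem hasFDerivWithinAt_semiForm {s : Set (Ambient p q)} {f g : Ambient p q → Ambient p q}
    {f' g' : Ambient p q →L[ℝ] Ambient p q} {x : Ambient p q}
    (hf : HasFDerivWithinAt f f' s x) (hg : HasFDerivWithinAt g g' s x) :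
    HasFDerivWithinAt (fun y => ⟪f y, g y⟫)
      ((semiForm _ _ (f x)).comp g' + ((semiForm _ _).flip (g x)).comp f') s x :=
  (semiForm _ _).hasFDerivWithinAt_of_bilinear hf hg

theorem bracket_apply {X Y : Ambient p q → Ambient p q} {X' Y' : Ambient p q →L[ℝ] Ambient p q}
    {x : Ambient p q} (hx : x ∈ pseudoSphere p q)
    (hX : HasFDerivWithinAt X X' (pseudoSphere p q) x)
    (hY : HasFDerivWithinAt Y Y' (pseudoSphere p q) x)
    (hXt : X x ∈ tangent x) (hYt : Y x ∈ tangent x) :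
    bracket X Y x = Y' (X x) - X' (Y x) := by
  rw [bracket, VectorField.lieBracketWithin, fderivWithin_eq_of_mem_tangent hY hx hXt,
    fderivWithin_eq_of_mem_tangent hX hx hYt]

theorem dirDeriv_apply {X : Ambient p q → Ambient p q} {f : Ambient p q → ℝ}
    {f' : Ambient p q →L[ℝ] ℝ} {x : Ambient p q} (hx : x ∈ pseudoSphere p q)
    (hf : HasFDerivWithinAt f f' (pseudoSphere p q) x) (hXt : X x ∈ tangent x) :
    dirDeriv X f x = f' (X x) :=
  fderivWithin_eq_of_mem_tangent hf hx hXt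

/-- The derivative of a tangent field `X` in a tangent direction `w` has normal component
`-⟪w, X x⟫`. -/
theorem semiForm_deriv_of_tangent {X : Ambient p q → Ambient p q}
    {X' : Ambient p q →L[ℝ] Ambient p q} {x w : Ambient p q} (hx : x ∈ pseudoSphere p q)
    (hX : HasFDerivWithinAt X X' (pseudoSphere p q) x)
    (hXt : ∀ y ∈ pseudoSphere p q, X y ∈ tangent y) (hw : w ∈ tangent x) :
    ⟪x, X' w⟫ = -⟪w, X x⟫ := by
  have h1 := hasFDerivWithinAt_semiForm (hasFDerivWithinAt_id x (pseudoSphere p q)) hX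
  have h2 : HasFDerivWithinAt (fun y => ⟪y, X y⟫) (0 : Ambient p q →L[ℝ] ℝ)
      (pseudoSphere p q) x :=
    (hasFDerivWithinAt_const (0 : ℝ) x _).congr (fun y hy => hXt y hy) (hXt x hx)
  have h3 := (fderivWithin_eq_of_mem_tangent h1 hx hw).symm.trans
    (fderivWithin_eq_of_mem_tangent h2 hx hw)
  simp at h3
  linarith

/-! ### Cross products give pseudo-Kähler structures -/

/-- If the ambient space carries a cross product, that is, a skew-symmetric product, skew-adjoint
in its second argument and satisfying the double product identity, then the product with the
position vector is a pseudo-Kähler structure. -/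
theorem isPseudoKahler_of_cross (C : Ambient p q →L[ℝ] Ambient p q →L[ℝ] Ambient p q)
    (skew : ∀ a b, C a b = -C b a) (adj : ∀ a b c, ⟪C a b, c⟫ = -⟪b, C a c⟫)
    (double : ∀ a b c, C a (C b c) = ⟪a, c⟫ • b - ⟪a, b⟫ • c) :
    IsPseudoKahler (fun x => C x) := by
  have alt : ∀ a, C a a = 0 := fun a => self_eq_neg.1 (skew a a)
  have ht : ∀ x v, C x v ∈ tangent x := fun x v => by
    have := adj x v x
    rw [alt, map_zero, neg_zero, semiForm_comm] at this
    exact this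
  have hsq : ∀ x ∈ pseudoSphere p q, ∀ v ∈ tangent x, C x (C x v) = -v := fun x hx v hv => by
    rw [double, mem_tangent_iff.1 hv, mem_iff.1 hx]; simp
  have hdiff : ∀ {X : Ambient p q → Ambient p q} {x}, IsSmoothVectorField X →
      x ∈ pseudoSphere p q → HasFDerivWithinAt X (fderivWithin ℝ X (pseudoSphere p q) x)
        (pseudoSphere p q) x := fun hX hx =>
    ((hX.1 _ hx).differentiableWithinAt (by simp)).hasFDerivWithinAt
  have hC : ∀ {X : Ambient p q → Ambient p q} {X' x},
      HasFDerivWithinAt X X' (pseudoSphere p q) x →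
      HasFDerivWithinAt (fun y => C y (X y)) ((C x).comp X' + C.flip (X x))
        (pseudoSphere p q) x := fun {X X' x} hX =>
    C.hasFDerivWithinAt_of_bilinear (hasFDerivWithinAt_id x _) hX
  refine ⟨⟨⟨C.contDiff.contDiffOn, fun x _ v _ => ht x v, hsq⟩, ?_⟩, ?_, ?_⟩
  -- The derivatives of `X` and `Y` enter the Nijenhuis tensor as `J² [X, Y] + [X, Y] = 0`; what
  -- remains is `(JX) × Y - (JY) × X` and products of `x` with the normal vector `X × Y`.
  · intro X Y hX hY x hx
    have hXx := hX.2 x hx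
    have hYx := hY.2 x hx
    have dX := hdiff hX hx
    have dY := hdiff hY hx
    have nX := fun w hw => semiForm_deriv_of_tangent (w := w) hx dX hX.2 hw
    have nY := fun w hw => semiForm_deriv_of_tangent (w := w) hx dY hY.2 hw
    set X' := fderivWithin ℝ X (pseudoSphere p q) x
    set Y' := fderivWithin ℝ Y (pseudoSphere p q) x
    have hbr : Y' (X x) - X' (Y x) ∈ tangent x := by
      rw [mem_tangent_iff, map_sub, nY _ hXx, nX _ hYx, semiForm_comm]; ring
    have e := hsq x hx _ hbr
    rw [nijenhuis, bracket_apply hx (hC dX) (hC dY) (ht _ _) (ht _ _),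
      bracket_apply hx (hC dX) dY (ht _ _) hYx, bracket_apply hx dX (hC dY) hXx (ht _ _),
      bracket_apply hx dX dY hXx hYx]
    have e1 : C (C x (X x)) (Y x) = -(⟪Y x, X x⟫ • x) := by
      rw [skew, double, semiForm_comm _ x, mem_tangent_iff.1 hYx]; simp
    have e2 : C (C x (Y x)) (X x) = -(⟪Y x, X x⟫ • x) := by
      rw [skew, double, semiForm_comm _ x, mem_tangent_iff.1 hXx, semiForm_comm]; simp
    have e3 : C x (C (X x) (Y x)) = 0 := by
      rw [double, mem_tangent_iff.1 hXx, mem_tangent_iff.1 hYx]; simp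
    have e4 : C x (C (Y x) (X x)) = 0 := by
      rw [double, mem_tangent_iff.1 hXx, mem_tangent_iff.1 hYx]; simp
    simp only [add_apply, ContinuousLinearMap.comp_apply,
      ContinuousLinearMap.flip_apply, map_sub, map_add, e1, e2, e3, e4] at e ⊢
    rw [sub_eq_iff_eq_add] at e
    rw [e]
    abel
  · intro x hx v hv w hw
    have := adj x v (C x w)
    rw [hsq x hx w hw, map_neg, neg_neg] at this
    exact this
  -- The derivatives of the fields cancel against the brackets; the derivative of the position
  -- vector leaves triple products of tangent vectors.
  · intro X Y Z hX hY hZ x hx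
    have hXx := hX.2 x hx
    have hYx := hY.2 x hx
    have hZx := hZ.2 x hx
    have dX := hdiff hX hx
    have dY := hdiff hY hx
    have dZ := hdiff hZ hx
    have hcop : ∀ u ∈ tangent x, ∀ v ∈ tangent x, ∀ w ∈ tangent x, ⟪C u v, w⟫ = 0 := by
      intro u hu v hv w hw
      have h1 : C x (C u v) = 0 := by
        rw [double, mem_tangent_iff.1 hu, mem_tangent_iff.1 hv]; simp
      -- the product of two tangent vectors is normal
      have h2 := double x x (C u v)
      rw [h1, map_zero, mem_iff.1 hx, one_smul] at h2
      rw [← sub_eq_zero.1 h2.symm, map_smul, smul_apply,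
        mem_tangent_iff.1 hw, smul_zero]
    have cyc : ∀ a b c, ⟪C a b, c⟫ = ⟪C b c, a⟫ := fun a b c => by
      rw [skew, map_neg, neg_apply, adj, neg_neg, semiForm_comm, adj, skew,
        map_neg, neg_neg, semiForm_comm]
    set X' := fderivWithin ℝ X (pseudoSphere p q) x
    set Y' := fderivWithin ℝ Y (pseudoSphere p q) x
    set Z' := fderivWithin ℝ Z (pseudoSphere p q) x
    have k1 := hasFDerivWithinAt_semiForm (hC dY) dZ
    have k2 := hasFDerivWithinAt_semiForm (hC dZ) dX
    have k3 := hasFDerivWithinAt_semiForm (hC dX) dY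
    unfold dKahlerForm kahlerForm
    simp only [semiInner_eq_semiForm]
    rw [dirDeriv_apply hx k1 hXx, dirDeriv_apply hx k2 hYx, dirDeriv_apply hx k3 hZx,
      bracket_apply hx dX dY hXx hYx, bracket_apply hx dY dZ hYx hZx,
      bracket_apply hx dZ dX hZx hXx]
    simp only [add_apply, ContinuousLinearMap.comp_apply,
      ContinuousLinearMap.flip_apply, map_sub, map_add, sub_apply,
      hcop _ hXx _ hYx _ hZx, hcop _ hYx _ hZx _ hXx, hcop _ hZx _ hXx _ hYx]
    have s : ∀ b c, ⟪C x b, c⟫ = -⟪C x c, b⟫ := fun b c => by rw [adj, semiForm_comm]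
    rw [s (Y x) (Z' (X x)), s (Z x) (X' (Y x)), s (X x) (Y' (Z x))]
    ring

/-- On the sphere `S^2` the cross product of `ℝ^3` gives a Kähler structure. -/
theorem exists_isPseudoKahler_one_zero :
    ∃ J : Ambient 1 0 → Ambient 1 0 →L[ℝ] Ambient 1 0, IsPseudoKahler J := by
  let f : Ambient 1 0 → Ambient 1 0 → Ambient 1 0 := fun x y =>
    Sum.elim ![x (.inl 1) * y (.inl 2) - x (.inl 2) * y (.inl 1),
      x (.inl 2) * y (.inl 0) - x (.inl 0) * y (.inl 2),
      x (.inl 0) * y (.inl 1) - x (.inl 1) * y (.inl 0)] Fin.elim0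
  refine ⟨_, isPseudoKahler_of_cross (LinearMap.mk₂ ℝ f ?_ ?_ ?_ ?_).toContinuousBilinearMap
    ?_ ?_ ?_⟩
  all_goals intros
  all_goals try (ext i; rcases i with i | i <;> fin_cases i)
  all_goals simp [f, ← semiInner_eq_semiForm, semiInner, Fin.sum_univ_three]
  all_goals ring

/-- On the two-sheeted hyperboloid in `ℝ^{1,2}` the Lorentzian cross product, that is, the one with
`⟪a × b, c⟫ = det(a, b, c)`, gives a pseudo-Kähler structure. -/
theorem exists_isPseudoKahler_zero_one :
    ∃ J : Ambient 0 1 → Ambient 0 1 →L[ℝ] Ambient 0 1, IsPseudoKahler J := by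
  let f : Ambient 0 1 → Ambient 0 1 → Ambient 0 1 := fun x y =>
    Sum.elim ![x (.inr 0) * y (.inr 1) - x (.inr 1) * y (.inr 0)]
      ![x (.inl 0) * y (.inr 1) - x (.inr 1) * y (.inl 0),
        x (.inr 0) * y (.inl 0) - x (.inl 0) * y (.inr 0)]
  refine ⟨_, isPseudoKahler_of_cross (LinearMap.mk₂ ℝ f ?_ ?_ ?_ ?_).toContinuousBilinearMap
    ?_ ?_ ?_⟩
  all_goals intros
  all_goals try (ext i; rcases i with i | i <;> fin_cases i)
  all_goals simp [f, ← semiInner_eq_semiForm, semiInner, Fin.sum_univ_two]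
  all_goals ring

/-! ### Radial extension of an almost complex structure -/

/-- The orthogonal projection `v ↦ v - ⟪x, v⟫ x` onto the tangent space at a point `x` of the
pseudo-sphere. -/
noncomputable def tanProj (x : Ambient p q) : Ambient p q →L[ℝ] Ambient p q :=
  ContinuousLinearMap.id ℝ _ - (semiForm _ _ x).smulRight x

theorem tanProj_apply (x v : Ambient p q) : tanProj x v = v - ⟪x, v⟫ • x := by
  simp [tanProj]

theorem tanProj_mem_tangent {x : Ambient p q} (hx : x ∈ pseudoSphere p q) (v : Ambient p q) :
    tanProj x v ∈ tangent x := by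
  rw [mem_tangent_iff, tanProj_apply, map_sub, map_smul, mem_iff.1 hx]; simp

theorem tanProj_of_mem_tangent {x v : Ambient p q} (hv : v ∈ tangent x) : tanProj x v = v := by
  rw [tanProj_apply, mem_tangent_iff.1 hv]; simp

theorem contDiff_tanProj : ContDiff ℝ ∞ (tanProj : Ambient p q → _) := by
  unfold tanProj; fun_prop

theorem isSmoothVectorField_tanProj (v : Ambient p q) :
    IsSmoothVectorField (fun y : Ambient p q => tanProj y v) :=
  ⟨(contDiff_tanProj.clm_apply contDiff_const).contDiffOn, fun _ hx => tanProj_mem_tangent hx v⟩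

theorem hasFDerivWithinAt_tanProj (s : Set (Ambient p q)) (x v : Ambient p q) :
    HasFDerivWithinAt (fun y : Ambient p q => tanProj y v)
      (-(⟪x, v⟫ • ContinuousLinearMap.id ℝ _ + ((semiForm _ _).flip v).smulRight x)) s x := by
  have h : HasFDerivWithinAt (fun y : Ambient p q => ⟪y, v⟫) ((semiForm _ _).flip v) s x :=
    ((semiForm _ _).flip v).hasFDerivWithinAt
  have h1 := (h.smul (hasFDerivWithinAt_id x s)).const_sub v
  simpa only [tanProj_apply] using! h1

/-- A tangent vector orthogonal to the tangent space vanishes; hence a vector orthogonal to the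
tangent space is normal. -/
theorem eq_smul_of_forall_tangent {x z : Ambient p q} (hx : x ∈ pseudoSphere p q)
    (h : ∀ w ∈ tangent x, ⟪z, w⟫ = 0) : z = ⟪x, z⟫ • x := by
  rw [← sub_eq_zero]
  refine eq_zero_of_semiForm_eq_zero fun y => ?_
  have h1 := h _ (tanProj_mem_tangent hx y)
  rw [tanProj_apply, map_sub, map_smul] at h1
  rw [map_sub, map_smul, sub_apply, smul_apply, semiForm_comm x z]
  simpa [mul_comm] using! h1

/-- The radial projection `y ↦ y / √⟪y, y⟫` of the cone `⟪y, y⟫ > 0` onto the pseudo-sphere. -/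
noncomputable def radialProj (y : Ambient p q) : Ambient p q := (√⟪y, y⟫)⁻¹ • y

theorem radialProj_mem {y : Ambient p q} (hy : 0 < ⟪y, y⟫) : radialProj y ∈ pseudoSphere p q := by
  have hs := Real.sq_sqrt hy.le
  have h0 := (Real.sqrt_pos.2 hy).ne'
  rw [mem_iff, radialProj, map_smul, map_smul, smul_apply, smul_eq_mul, smul_eq_mul]
  field_simp
  exact hs.symm

theorem radialProj_of_mem {y : Ambient p q} (hy : y ∈ pseudoSphere p q) : radialProj y = y := by
  rw [radialProj, mem_iff.1 hy]; simp

theorem radialProj_smul {c : ℝ} (hc : 0 < c) (y : Ambient p q) :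
    radialProj (c • y) = radialProj y := by
  have : ⟪c • y, c • y⟫ = c ^ 2 * ⟪y, y⟫ := by
    rw [map_smul, map_smul, smul_apply, smul_eq_mul, smul_eq_mul]; ring
  rw [radialProj, radialProj, this, Real.sqrt_mul (sq_nonneg c), Real.sqrt_sq hc.le, smul_smul]
  congr 1
  field_simp

theorem contDiffAt_radialProj {y : Ambient p q} (hy : 0 < ⟪y, y⟫) :
    ContDiffAt ℝ ∞ (radialProj : Ambient p q → _) y := by
  have h : ContDiffAt ℝ ∞ (fun y : Ambient p q => ⟪y, y⟫) y := by fun_prop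
  exact ((h.sqrt hy.ne').inv (Real.sqrt_pos.2 hy).ne').smul contDiffAt_id

theorem eventually_pos {x : Ambient p q} (hx : x ∈ pseudoSphere p q) :
    ∀ᶠ y : Ambient p q in nhds x, 0 < ⟪y, y⟫ := by
  have h : Continuous (fun y : Ambient p q => ⟪y, y⟫) := by fun_prop
  exact (isOpen_lt continuous_const h).mem_nhds (by simp [mem_iff.1 hx])

/-- The extension of a field of endomorphisms of the tangent spaces to the cone `⟪y, y⟫ > 0`: it
is constant along rays, and vanishes on the position vector. -/
noncomputable def radialExt (J : Ambient p q → Ambient p q →L[ℝ] Ambient p q) (y : Ambient p q) :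
    Ambient p q →L[ℝ] Ambient p q :=
  (J (radialProj y)).comp (tanProj (radialProj y))

section

variable {J : Ambient p q → Ambient p q →L[ℝ] Ambient p q} {x : Ambient p q}

theorem radialExt_of_mem (J : Ambient p q → Ambient p q →L[ℝ] Ambient p q)
    (hx : x ∈ pseudoSphere p q) (v : Ambient p q) : radialExt J x v = J x (tanProj x v) := by
  rw [radialExt, radialProj_of_mem hx]; rfl

theorem radialExt_of_mem_tangent (J : Ambient p q → Ambient p q →L[ℝ] Ambient p q)
    (hx : x ∈ pseudoSphere p q) {v : Ambient p q} (hv : v ∈ tangent x) :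
    radialExt J x v = J x v := by
  rw [radialExt_of_mem J hx, tanProj_of_mem_tangent hv]

theorem radialExt_self (J : Ambient p q → Ambient p q →L[ℝ] Ambient p q)
    (hx : x ∈ pseudoSphere p q) : radialExt J x x = 0 := by
  rw [radialExt_of_mem J hx, tanProj_apply, mem_iff.1 hx]; simp

theorem IsAlmostComplex.radialExt_mem_tangent (hJ : IsAlmostComplex J)
    (hx : x ∈ pseudoSphere p q) (v : Ambient p q) : radialExt J x v ∈ tangent x := by
  rw [radialExt_of_mem J hx]
  exact hJ.map_tangent x hx _ (tanProj_mem_tangent hx v)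

theorem IsAlmostComplex.radialExt_radialExt (hJ : IsAlmostComplex J)
    (hx : x ∈ pseudoSphere p q) (v : Ambient p q) :
    radialExt J x (radialExt J x v) = -tanProj x v := by
  rw [radialExt_of_mem_tangent J hx (hJ.radialExt_mem_tangent hx v), radialExt_of_mem J hx,
    hJ.sq_eq_neg x hx _ (tanProj_mem_tangent hx v)]

theorem IsAlmostComplex.contDiffAt_radialExt (hJ : IsAlmostComplex J)
    (hx : x ∈ pseudoSphere p q) : ContDiffAt ℝ ∞ (radialExt J) x := by
  have hr : ContDiffAt ℝ ∞ radialProj x := contDiffAt_radialProj (by simp [mem_iff.1 hx])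
  have h1 : ContDiffAt ℝ ∞ (fun y => J (radialProj y)) x := by
    have h2 := (hJ.smooth _ (radialProj_mem (y := x) (by simp [mem_iff.1 hx]))).comp
      (s := {y : Ambient p q | 0 < ⟪y, y⟫}) x hr.contDiffWithinAt fun y hy => radialProj_mem hy
    exact h2.contDiffAt (eventually_pos hx)
  exact h1.clm_comp (contDiff_tanProj.contDiffAt.comp x hr)

theorem IsAlmostComplex.hasFDerivAt_radialExt (hJ : IsAlmostComplex J)
    (hx : x ∈ pseudoSphere p q) : HasFDerivAt (radialExt J) (fderiv ℝ (radialExt J) x) x :=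
  ((hJ.contDiffAt_radialExt hx).differentiableAt (by simp)).hasFDerivAt

theorem IsAlmostComplex.fderiv_radialExt_self (hJ : IsAlmostComplex J)
    (hx : x ∈ pseudoSphere p q) : fderiv ℝ (radialExt J) x x = 0 := by
  have h1 := (hJ.hasFDerivAt_radialExt hx).hasLineDerivAt x
  have h2 : HasDerivAt (fun t : ℝ => radialExt J (x + t • x)) 0 0 := by
    refine (hasDerivAt_const (0 : ℝ) (radialExt J x)).congr_of_eventuallyEq ?_
    filter_upwards [lt_mem_nhds (show (-1 : ℝ) < 0 by norm_num)] with t ht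
    have : x + t • x = (1 + t) • x := by rw [add_smul, one_smul]
    rw [this, radialExt, radialExt, radialProj_smul (by linarith)]
  exact HasDerivAt.unique h1 h2

/-- The derivative of the radial extension, applied to a fixed vector, within a set. -/
theorem IsAlmostComplex.hasFDerivWithinAt_radialExt_apply (hJ : IsAlmostComplex J)
    (hx : x ∈ pseudoSphere p q) (s : Set (Ambient p q)) (v : Ambient p q) :
    HasFDerivWithinAt (fun y => radialExt J y v) ((fderiv ℝ (radialExt J) x).flip v) s x := by
  have := ((hJ.hasFDerivAt_radialExt hx).hasFDerivWithinAt (s := s)).clm_apply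
    (hasFDerivWithinAt_const v x s)
  simpa using! this

/-- Functions agreeing on the pseudo-sphere have the same derivatives in tangent directions. -/
theorem deriv_eq_of_eqOn {F : Type*} [NormedAddCommGroup F] [NormedSpace ℝ F]
    {f g : Ambient p q → F} {f' g' : Ambient p q →L[ℝ] F} (hx : x ∈ pseudoSphere p q)
    (hf : HasFDerivWithinAt f f' (pseudoSphere p q) x)
    (hg : HasFDerivWithinAt g g' (pseudoSphere p q) x)
    (h : ∀ y ∈ pseudoSphere p q, f y = g y) {u : Ambient p q} (hu : u ∈ tangent x) :
    f' u = g' u :=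
  (fderivWithin_eq_of_mem_tangent hf hx hu).symm.trans
    (fderivWithin_eq_of_mem_tangent (hg.congr h (h x hx)) hx hu)

theorem IsAlmostComplex.fderiv_radialExt_apply_self (hJ : IsAlmostComplex J)
    (hx : x ∈ pseudoSphere p q) {u : Ambient p q} (hu : u ∈ tangent x) :
    fderiv ℝ (radialExt J) x u x = -radialExt J x u := by
  have h := deriv_eq_of_eqOn hx
    ((hJ.hasFDerivAt_radialExt hx).hasFDerivWithinAt.clm_apply (hasFDerivWithinAt_id x _))
    (hasFDerivWithinAt_const (0 : Ambient p q) x _) (fun y hy => radialExt_self J hy) hu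
  simp at h
  rw [eq_neg_iff_add_eq_zero, add_comm]
  exact h

theorem IsAlmostComplex.semiForm_fderiv_radialExt (hJ : IsAlmostComplex J)
    (hx : x ∈ pseudoSphere p q) {u : Ambient p q} (hu : u ∈ tangent x) (v : Ambient p q) :
    ⟪x, fderiv ℝ (radialExt J) x u v⟫ = -⟪u, radialExt J x v⟫ :=
  semiForm_deriv_of_tangent hx (hJ.hasFDerivWithinAt_radialExt_apply hx _ v)
    (fun _ hy => hJ.radialExt_mem_tangent hy v) hu

theorem IsPseudoKahler.radialExt_skew (hJ : IsPseudoKahler J) (hx : x ∈ pseudoSphere p q)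
    (v w : Ambient p q) : ⟪radialExt J x v, w⟫ = -⟪v, radialExt J x w⟫ := by
  have ha := hJ.toIsAlmostComplex
  have hw := ha.radialExt_mem_tangent hx w
  have hv := ha.radialExt_mem_tangent hx v
  have e := hJ.orthogonal x hx _ (tanProj_mem_tangent hx v) _ hw
  rw [semiInner_eq_semiForm, semiInner_eq_semiForm, ← radialExt_of_mem J hx,
    ← radialExt_of_mem_tangent J hx hw, ha.radialExt_radialExt hx, tanProj_apply,
    tanProj_apply] at e
  simp only [map_neg, map_sub, map_smul, sub_apply, smul_apply, mem_tangent_iff.1 hw,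
    semiForm_comm _ x, mem_tangent_iff.1 hv, smul_zero, sub_zero] at e
  linarith

end

/-! ### The associated complex structure is parallel -/

section

variable {J : Ambient p q → Ambient p q →L[ℝ] Ambient p q} {x : Ambient p q}

theorem IsPseudoKahler.fderiv_radialExt_skew (hJ : IsPseudoKahler J) (hx : x ∈ pseudoSphere p q)
    {u : Ambient p q} (hu : u ∈ tangent x) (v w : Ambient p q) :
    ⟪fderiv ℝ (radialExt J) x u v, w⟫ = -⟪fderiv ℝ (radialExt J) x u w, v⟫ := by
  have ha := hJ.toIsAlmostComplex
  have h := deriv_eq_of_eqOn hx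
    (hasFDerivWithinAt_semiForm (ha.hasFDerivWithinAt_radialExt_apply hx _ v)
      (hasFDerivWithinAt_const w x _))
    (hasFDerivWithinAt_semiForm (hasFDerivWithinAt_const v x _)
      (ha.hasFDerivWithinAt_radialExt_apply hx _ w)).neg
    (fun y hy => hJ.radialExt_skew hy v w) hu
  simp at h
  rw [h, semiForm_comm]

/-- The covariant derivatives of `J` anticommute with `J`. -/
theorem IsPseudoKahler.fderiv_radialExt_comm (hJ : IsPseudoKahler J) (hx : x ∈ pseudoSphere p q)
    {u v w : Ambient p q} (hu : u ∈ tangent x) (hv : v ∈ tangent x) (hw : w ∈ tangent x) :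
    ⟪fderiv ℝ (radialExt J) x u (radialExt J x v), w⟫
      = ⟪fderiv ℝ (radialExt J) x u v, radialExt J x w⟫ := by
  have ha := hJ.toIsAlmostComplex
  have h := deriv_eq_of_eqOn hx
    ((ha.hasFDerivAt_radialExt hx).hasFDerivWithinAt.clm_apply
      (ha.hasFDerivWithinAt_radialExt_apply hx _ v))
    (hasFDerivWithinAt_tanProj _ x v).neg
    (fun y hy => ha.radialExt_radialExt hy v) hu
  simp [mem_tangent_iff.1 hv] at h
  have h2 := congrArg (fun z => ⟪z, w⟫) h
  simp [mem_tangent_iff.1 hw, hJ.radialExt_skew hx] at h2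
  linarith

theorem IsAlmostComplex.hasFDerivWithinAt_apply_tanProj (hJ : IsAlmostComplex J)
    (hx : x ∈ pseudoSphere p q) (v : Ambient p q) :
    HasFDerivWithinAt (fun y => J y (tanProj y v)) ((fderiv ℝ (radialExt J) x).flip v)
      (pseudoSphere p q) x :=
  (hJ.hasFDerivWithinAt_radialExt_apply hx _ v).congr
    (fun _ hy => (radialExt_of_mem J hy v).symm) (radialExt_of_mem J hx v).symm

/-- The fields obtained by projecting constant vectors commute at the points where these vectors
are tangent. -/
theorem bracket_tanProj (hx : x ∈ pseudoSphere p q) {v w : Ambient p q} (hv : v ∈ tangent x)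
    (hw : w ∈ tangent x) : bracket (fun y => tanProj y v) (fun y => tanProj y w) x = 0 := by
  rw [bracket_apply hx (hasFDerivWithinAt_tanProj _ x v) (hasFDerivWithinAt_tanProj _ x w)
    (tanProj_mem_tangent hx v) (tanProj_mem_tangent hx w)]
  simp [mem_tangent_iff.1 hv, mem_tangent_iff.1 hw, tanProj_of_mem_tangent hv,
    tanProj_of_mem_tangent hw, semiForm_comm v w]

/-- The vanishing of the Nijenhuis tensor in terms of the covariant derivative of `J`. -/
theorem IsPseudoKahler.nijenhuis_radialExt (hJ : IsPseudoKahler J) (hx : x ∈ pseudoSphere p q)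
    {v w : Ambient p q} (hv : v ∈ tangent x) (hw : w ∈ tangent x) (z : Ambient p q) :
    ⟪fderiv ℝ (radialExt J) x (radialExt J x v) w, z⟫
      - ⟪fderiv ℝ (radialExt J) x (radialExt J x w) v, z⟫
      - ⟪fderiv ℝ (radialExt J) x w v, radialExt J x z⟫
      + ⟪fderiv ℝ (radialExt J) x v w, radialExt J x z⟫ = 0 := by
  have ha := hJ.toIsAlmostComplex
  have h := hJ.integrable _ _ (isSmoothVectorField_tanProj v) (isSmoothVectorField_tanProj w) x hx
  have dv := hasFDerivWithinAt_tanProj (pseudoSphere p q) x v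
  have dw := hasFDerivWithinAt_tanProj (pseudoSphere p q) x w
  have dJv := ha.hasFDerivWithinAt_apply_tanProj hx v
  have dJw := ha.hasFDerivWithinAt_apply_tanProj hx w
  have tv := tanProj_mem_tangent hx v
  have tw := tanProj_mem_tangent hx w
  have tJv := ha.map_tangent x hx _ tv
  have tJw := ha.map_tangent x hx _ tw
  have hJv : J x (tanProj x v) = radialExt J x v := (radialExt_of_mem J hx v).symm
  have hJw : J x (tanProj x w) = radialExt J x w := (radialExt_of_mem J hx w).symm
  have b1 : bracket (fun y => J y (tanProj y v)) (fun y => tanProj y w) x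
      = -(⟪w, radialExt J x v⟫ • x + fderiv ℝ (radialExt J) x w v) := by
    rw [bracket_apply hx dJv dw tJv tw, hJv, tanProj_of_mem_tangent hw]
    simp [mem_tangent_iff.1 hw, semiForm_comm w]
    abel
  have b2 : bracket (fun y => tanProj y v) (fun y => J y (tanProj y w)) x
      = ⟪v, radialExt J x w⟫ • x + fderiv ℝ (radialExt J) x v w := by
    rw [bracket_apply hx dv dJw tv tJw, hJw, tanProj_of_mem_tangent hv]
    simp [mem_tangent_iff.1 hv, semiForm_comm v]
    abel
  -- both brackets are tangent, and there `J` agrees with its extension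
  have t1 : ⟪w, radialExt J x v⟫ • x + fderiv ℝ (radialExt J) x w v ∈ tangent x := by
    rw [mem_tangent_iff, map_add, map_smul, mem_iff.1 hx, ha.semiForm_fderiv_radialExt hx hw]
    simp
  have t2 : ⟪v, radialExt J x w⟫ • x + fderiv ℝ (radialExt J) x v w ∈ tangent x := by
    rw [mem_tangent_iff, map_add, map_smul, mem_iff.1 hx, ha.semiForm_fderiv_radialExt hx hv]
    simp
  rw [nijenhuis, b1, b2, bracket_tanProj hx hv hw, bracket_apply hx dJv dJw tJv tJw, map_neg,
    ← radialExt_of_mem_tangent J hx t1, ← radialExt_of_mem_tangent J hx t2, hJv, hJw] at h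
  have h2 := congrArg (fun y => ⟪y, z⟫) h
  simp [radialExt_self J hx, hJ.radialExt_skew hx] at h2
  linarith

/-- The closedness of the associated 2-form in terms of the covariant derivative of `J`. -/
theorem IsPseudoKahler.cyclic_fderiv_radialExt (hJ : IsPseudoKahler J)
    (hx : x ∈ pseudoSphere p q) {u v w : Ambient p q} (hu : u ∈ tangent x) (hv : v ∈ tangent x)
    (hw : w ∈ tangent x) :
    ⟪fderiv ℝ (radialExt J) x u v, w⟫ + ⟪fderiv ℝ (radialExt J) x v w, u⟫
      + ⟪fderiv ℝ (radialExt J) x w u, v⟫ = 0 := by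
  have ha := hJ.toIsAlmostComplex
  have h := hJ.closed _ _ _ (isSmoothVectorField_tanProj u) (isSmoothVectorField_tanProj v)
    (isSmoothVectorField_tanProj w) x hx
  have key : ∀ a ∈ tangent x, ∀ b ∈ tangent x, ∀ c ∈ tangent x,
      dirDeriv (fun y => tanProj y a)
        (kahlerForm J (fun y => tanProj y b) (fun y => tanProj y c)) x
      = ⟪fderiv ℝ (radialExt J) x a b, c⟫ := by
    intro a hta b htb c htc
    unfold kahlerForm
    simp only [semiInner_eq_semiForm]
    rw [dirDeriv_apply hx (hasFDerivWithinAt_semiForm (ha.hasFDerivWithinAt_apply_tanProj hx b)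
      (hasFDerivWithinAt_tanProj _ x c)) (tanProj_mem_tangent hx a)]
    simp [tanProj_of_mem_tangent hta, tanProj_of_mem_tangent htc, tanProj_of_mem_tangent htb,
      mem_tangent_iff.1 htc, semiForm_comm _ x,
      mem_tangent_iff.1 (ha.map_tangent x hx b htb)]
  rw [dKahlerForm, key u hu v hv w hw, key v hv w hw u hu, key w hw u hu v hv] at h
  simp only [kahlerForm, bracket_tanProj hx hu hv, bracket_tanProj hx hv hw,
    bracket_tanProj hx hw hu, semiInner_eq_semiForm, map_zero, zero_apply, sub_zero] at h
  exact h

/-- A pseudo-Kähler structure is parallel. With `A(u, v, w) = ⟪(∇_u J) v, w⟫`, twice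
`A(u, v, w)` is `dω(u, v, w) - dω(u, Jv, Jw) + ⟪N(v, w), Ju⟫`. -/
theorem IsPseudoKahler.parallel (hJ : IsPseudoKahler J) (hx : x ∈ pseudoSphere p q)
    {u v w : Ambient p q} (hu : u ∈ tangent x) (hv : v ∈ tangent x) (hw : w ∈ tangent x) :
    ⟪fderiv ℝ (radialExt J) x u v, w⟫ = 0 := by
  have ha := hJ.toIsAlmostComplex
  have kv := ha.radialExt_mem_tangent hx v
  have kw := ha.radialExt_mem_tangent hx w
  have c1 := hJ.cyclic_fderiv_radialExt hx hu hv hw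
  have c2 := hJ.cyclic_fderiv_radialExt hx hu kv kw
  have n := hJ.nijenhuis_radialExt hx hv hw (radialExt J x u)
  rw [ha.radialExt_radialExt hx, tanProj_of_mem_tangent hu, map_neg, map_neg] at n
  have f1 := hJ.fderiv_radialExt_comm hx hu hv kw
  rw [ha.radialExt_radialExt hx, tanProj_of_mem_tangent hw, map_neg] at f1
  have f2 := hJ.fderiv_radialExt_comm hx kv hw hu
  have f3 := hJ.fderiv_radialExt_skew hx kw v (radialExt J x u)
  have f4 := hJ.fderiv_radialExt_comm hx kw hu hv
  have f5 := hJ.fderiv_radialExt_skew hx hw v u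
  linarith

/-- The derivative of the radial extension of a pseudo-Kähler structure. -/
theorem IsPseudoKahler.fderiv_radialExt (hJ : IsPseudoKahler J) (hx : x ∈ pseudoSphere p q)
    (u v : Ambient p q) :
    fderiv ℝ (radialExt J) x u v = -(⟪radialExt J x v, u⟫ • x + ⟪x, v⟫ • radialExt J x u) := by
  have ha := hJ.toIsAlmostComplex
  have htt : ∀ a ∈ tangent x, ∀ b ∈ tangent x,
      fderiv ℝ (radialExt J) x a b = -(⟪radialExt J x b, a⟫ • x) := by
    intro a hta b htb
    rw [eq_smul_of_forall_tangent hx fun w hw => hJ.parallel hx hta htb hw,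
      ha.semiForm_fderiv_radialExt hx hta, semiForm_comm, neg_smul]
  have hdec : ∀ a, a = tanProj x a + ⟪x, a⟫ • x := fun a => by rw [tanProj_apply]; abel
  have htu := tanProj_mem_tangent hx u
  have htv := tanProj_mem_tangent hx v
  have ku : radialExt J x (tanProj x u) = radialExt J x u := by
    rw [tanProj_apply, map_sub, map_smul, radialExt_self J hx]; simp
  have kv : radialExt J x (tanProj x v) = radialExt J x v := by
    rw [tanProj_apply, map_sub, map_smul, radialExt_self J hx]; simp
  have kvu : ⟪radialExt J x v, tanProj x u⟫ = ⟪radialExt J x v, u⟫ := by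
    rw [tanProj_apply, map_sub, map_smul, semiForm_comm _ x,
      mem_tangent_iff.1 (ha.radialExt_mem_tangent hx v)]; simp
  calc fderiv ℝ (radialExt J) x u v
      = fderiv ℝ (radialExt J) x (tanProj x u) (tanProj x v + ⟪x, v⟫ • x) := by
        rw [← hdec v]
        conv_lhs => rw [hdec u, map_add, map_smul, ha.fderiv_radialExt_self hx, smul_zero,
          add_zero]
    _ = _ := by
        rw [map_add, map_smul, htt _ htu _ htv, ha.fderiv_radialExt_apply_self hx htu, ku, kv,
          kvu, smul_neg, neg_add]

/-! ### The curvature obstruction -/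

/-- The curvature of the pseudo-sphere commutes with a pseudo-Kähler structure: this is the
symmetry of the second derivative of the radial extension. -/
theorem IsPseudoKahler.curvature_comm (hJ : IsPseudoKahler J) (hx : x ∈ pseudoSphere p q)
    {u v w : Ambient p q} (hu : u ∈ tangent x) (hv : v ∈ tangent x) (hw : w ∈ tangent x) :
    ⟪J x v, u⟫ • w + ⟪w, v⟫ • J x u = ⟪J x v, w⟫ • u + ⟪u, v⟫ • J x w := by
  have ha := hJ.toIsAlmostComplex
  have hsm := ha.contDiffAt_radialExt hx
  have hd : DifferentiableAt ℝ (fderiv ℝ (radialExt J)) x :=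
    (hsm.fderiv_right (m := 1) (by norm_cast)).differentiableAt (by simp)
  have key : ∀ a ∈ tangent x, ∀ b ∈ tangent x,
      fderiv ℝ (fderiv ℝ (radialExt J)) x b a v
        = -(⟪J x v, a⟫ • b + ⟪b, v⟫ • J x a) := by
    intro a hta b htb
    have h1 : HasFDerivWithinAt (fun y => fderiv ℝ (radialExt J) y a v)
        (((fderiv ℝ (fderiv ℝ (radialExt J)) x).flip a).flip v) (pseudoSphere p q) x := by
      have := ((hd.hasFDerivAt.hasFDerivWithinAt (s := pseudoSphere p q)).clm_apply
        (hasFDerivWithinAt_const a x _)).clm_apply (hasFDerivWithinAt_const v x _)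
      simpa using! this
    have h2 := (((hasFDerivWithinAt_semiForm (ha.hasFDerivWithinAt_radialExt_apply hx
      (pseudoSphere p q) v) (hasFDerivWithinAt_const a x _)).smul
      (hasFDerivWithinAt_id x _)).add ((hasFDerivWithinAt_semiForm
      (hasFDerivWithinAt_id x _) (hasFDerivWithinAt_const v x _)).smul
      (ha.hasFDerivWithinAt_radialExt_apply hx _ a))).neg
    have h := deriv_eq_of_eqOn hx h1 h2 (fun y hy => hJ.fderiv_radialExt hy a v) htb
    simp [mem_tangent_iff.1 hv, mem_tangent_iff.1 hta, hJ.fderiv_radialExt hx b v,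
      radialExt_of_mem_tangent J hx hv, radialExt_of_mem_tangent J hx hta] at h
    rw [h]
    abel
  have hsymm := hsm.isSymmSndFDerivAt (by
    rw [minSmoothness_of_isRCLikeNormedField]; exact ENat.LEInfty.out) w u
  have := congrArg (fun L => L v) hsymm
  simp only [key u hu w hw, key w hw u hu] at this
  exact neg_injective this

/-- Above dimension 2 the curvature commutes with no orthogonal complex structure. -/
theorem IsPseudoKahler.add_lt_two (hJ : IsPseudoKahler J) : p + q < 2 := by
  by_contra! h2
  have ha := hJ.toIsAlmostComplex
  let e : Fin (2 * p + 1) ⊕ Fin (2 * q) → Ambient p q := fun k => Pi.single k 1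
  have : Nontrivial (Fin (2 * p + 1) ⊕ Fin (2 * q)) := by
    rw [← Fintype.one_lt_card_iff_nontrivial]; simp; omega
  obtain ⟨k, hk⟩ := exists_ne (Sum.inl 0 : Fin (2 * p + 1) ⊕ Fin (2 * q))
  set x := e (Sum.inl 0)
  set v := e k
  have hx : x ∈ pseudoSphere p q := by
    rw [mem_iff, ← semiInner_eq_semiForm]
    simp [x, e, semiInner, Pi.single_apply]
  have hv : v ∈ tangent x := by
    rw [mem_tangent_iff, ← semiInner_eq_semiForm]
    rcases k with k | k
    · simp only [ne_eq, Sum.inl.injEq] at hk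
      simp [x, v, e, semiInner, Pi.single_apply, hk]
    · simp [x, v, e, semiInner, Pi.single_apply]
  have hvv : ⟪v, v⟫ ≠ 0 := by
    rw [← semiInner_eq_semiForm]
    rcases k with k | k <;> simp [v, e, semiInner, Pi.single_apply]
  -- three linear conditions leave a nonzero solution in dimension at least 5
  let φ : Ambient p q →ₗ[ℝ] Fin 3 → ℝ := LinearMap.pi
    ![(semiForm _ _ x).toLinearMap, (semiForm _ _ v).toLinearMap,
      (semiForm _ _ (J x v)).toLinearMap]
  have hker : LinearMap.ker φ ≠ ⊥ := φ.ker_ne_bot_of_finrank_lt (by simp; omega)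
  obtain ⟨u, hu, hu0⟩ := (Submodule.ne_bot_iff _).1 hker
  have hxu : ⟪x, u⟫ = 0 := congrFun hu 0
  have hvu : ⟪v, u⟫ = 0 := congrFun hu 1
  have hJu : ⟪J x v, u⟫ = 0 := congrFun hu 2
  have hJv : ⟪J x v, v⟫ = 0 := by
    have := hJ.radialExt_skew hx v v
    rw [radialExt_of_mem_tangent J hx hv, semiForm_comm v] at this
    linarith
  have h := hJ.curvature_comm hx (u := u) hxu hv hv
  rw [hJu, hJv, semiForm_comm u, hvu, zero_smul, zero_smul, zero_add, zero_smul, zero_add] at h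
  have hJu0 := (smul_eq_zero.1 h).resolve_left hvv
  have := ha.sq_eq_neg x hx u hxu
  rw [hJu0, map_zero] at this
  exact hu0 (neg_eq_zero.1 this.symm)

end

end pseudoSphere

theorem mainTheorem4 (p q : ℕ) (hpq : 1 ≤ p + q) :
    (∃ J : SemiEuclidean (2 * p + 1) (2 * q) →
        SemiEuclidean (2 * p + 1) (2 * q) →L[ℝ] SemiEuclidean (2 * p + 1) (2 * q),
      pseudoSphere.IsPseudoKahler J) ↔ p + q = 1 := by
  constructor
  · rintro ⟨J, hJ⟩
    have := hJ.add_lt_two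
    omega
  · intro h
    obtain ⟨rfl, rfl⟩ | ⟨rfl, rfl⟩ : p = 1 ∧ q = 0 ∨ p = 0 ∧ q = 1 := by omega
    · exact pseudoSphere.exists_isPseudoKahler_one_zero
    · exact pseudoSphere.exists_isPseudoKahler_zero_one
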